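/- Let $(M,+,0)$ be a commutative monoid and let $M^{(-)}\colon \mathbf{Set}\to\mathbf{Set}$ be the monoid-valued functor: $M^{(X)}$ is the set of functions $\varphi\colon X\to M$ with $\varphi(x)=0$ for all but finitely many $x$, and for $f\colon X\to Y$ the map $M^{(f)}$ sends $\varphi$ to $y\mapsto\sum_{x\in f^{-1}(y)}\varphi(x)$. Call $M$ \emph{positive} if $a+b=0$ implies $a=b=0$, and \emph{refinable} if whenever $a_1+a_2=b_1+b_2$ there are $c_{11},c_{12},c_{21},c_{22}\in M$ with $c_{i1}+c_{i2}=a_i$ and $c_{1j}+c_{2j}=b_j$ for $i,j\in\{1,2\}$. Let $\mathbf{Rel}$ be the category of sets and relations. An \emph{extension} of a functor $F\colon\mathbf{Set}\to\mathbf{Set}$ is a functor $E\colon\mathbf{Rel}\to\mathbf{Rel}$ such that $E\circ G=G\circ F$, where $G\colon\mathbf{Set}\to\mathbf{Rel}$ is the identity on objects and sends each function to its graph. The \emph{Barr extension} of $F$ (which need not be functorial in general) sends a set $X$ to $FX$ and a relation $r\subseteq X\times Y$ with projections $\pi_1\colon r\to X$, $\pi_2\colon r\to Y$ to the relation $\{(F\pi_1(w),F\pi_2(w))\mid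 w\in F(r)\}\subseteq FX\times FY$. Then $M^{(-)}$ admits an extension if and only if $M$ is positive and refinable. In that case the Barr extension of $M^{(-)}$ is an extension of $M^{(-)}$, and it is the only one. -/

import Mathlib

open CategoryTheory

universe u

/-- The monoid-valued functor `M^(-)`: a set `X` is sent to the set of finitely supported functions
`X → M`, and a map `f : X → Y` to the map `φ ↦ (y ↦ ∑ x ∈ f⁻¹ y, φ x)`. -/
noncomputable def monoidValued (M : Type u) [AddCommMonoid M] : Type u ⥤ Type u where
  obj X := X →₀ M
  map f := TypeCat.ofHom fun φ => Finsupp.mapDomain f φ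
  map_id X := by
    refine ConcreteCategory.hom_ext _ _ fun (φ : X →₀ M) => ?_
    exact Finsupp.mapDomain_id
  map_comp {X Y Z} f g := by
    refine ConcreteCategory.hom_ext _ _ fun (φ : X →₀ M) => ?_
    exact Finsupp.mapDomain_comp (f := f) (g := g)

/-- A functor `E : Rel ⥤ Rel` is an extension of `F : Set ⥤ Set` if it commutes (strictly) with
`F` along the graph functor `Set ⥤ Rel`. -/
def IsRelExtension (F : Type u ⥤ Type u) (E : RelCat.{u} ⥤ RelCat.{u}) : Prop :=
  RelCat.graphFunctor ⋙ E = F ⋙ RelCat.graphFunctor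

/-- The action of the Barr extension on a relation `r` from `X` to `Y`: with `π₁ : r → X` and
`π₂ : r → Y` the projections, this is the composite of the converse of the graph of `F π₁` with
the graph of `F π₂`. -/
def barrRel (F : Type u ⥤ Type u) {X Y : Type u} (r : SetRel X Y) :
    SetRel (F.obj X) (F.obj Y) :=
  (Function.graph (F.map (TypeCat.ofHom fun p : r => p.1.1))).inv.comp
    (Function.graph (F.map (TypeCat.ofHom fun p : r => p.1.2)))

/-- The Barr extension of `F`, as an assignment on the objects and the morphisms of `Rel`. It need
not be functorial. -/
def barrExtension (F : Type u ⥤ Type u) : RelCat.{u} ⥤q RelCat.{u} where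
  obj X := RelCat.graphFunctor.obj (F.obj X)
  map r := RelCat.Hom.ofRel (barrRel F r.rel)

/-- `M` is positive: a sum is zero only if both summands are zero. -/
def IsPositiveMonoid (M : Type u) [AddCommMonoid M] : Prop :=
  ∀ a b : M, a + b = 0 → a = 0 ∧ b = 0

/-- `M` is refinable: whenever `a₁ + a₂ = b₁ + b₂`, there is a `2 × 2` matrix over `M` with row
sums `a₁, a₂` and column sums `b₁, b₂`. -/
def IsRefinableMonoid (M : Type u) [AddCommMonoid M] : Prop :=
  ∀ a₁ a₂ b₁ b₂ : M, a₁ + a₂ = b₁ + b₂ → ∃ c₁₁ c₁₂ c₂₁ c₂₂ : M,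
    c₁₁ + c₁₂ = a₁ ∧ c₂₁ + c₂₂ = a₂ ∧ c₁₁ + c₂₁ = b₁ ∧ c₁₂ + c₂₂ = b₂

/-!
A functor `E` on `Rel` extending `F` is determined by its values on converses of graphs, since every
relation is the converse of a graph followed by a graph. For surjective `f`, the converse of `f`
followed by `f` is the identity, so `E` sends the converse of `f` to a relation choosing, for each
`a`, only preimages of `a` under `F f`, and at least one. To see that all preimages occur, consider
a split surjection `p : P → X` with section `d`, and precompose it with the projection `P × K → P`
for a set `K` that is large compared to the supports of elements of `F`. An element of `F (P × K)`
cannot see all of a fibre over `P`, so the projection can be modified on its support to factor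
through `d` while staying surjective; hence `F d` gives a legal choice. Kernel pairs, whose
projections are split by the diagonal, then yield all preimages, for arbitrary `f`.
So `E` is the Barr extension, and `F` preserves weak pullbacks.

For `F = M^(-)`, preservation of the weak pullbacks given by products of two sets says that joint
distributions with prescribed marginals of equal mass exist: over `2 × ∅` this is positivity, over
`2 × 2` it is refinability. Conversely, refinability and positivity let one split a finitely
supported function along a decomposition of its image, which builds joint distributions one point
at a time.
-/

open SetRel
open scoped Cardinal

/-! ### Spans and weak pullbacks -/

section Span

variable {A B P P' X Y Z : Type*}

/-- The relation tabulated by a span `X ← P → Y`, the composite of the converse of the left leg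
with the right leg. The Barr extension applies `F` to the legs of such a span. -/
def spanRel (p : P → X) (q : P → Y) : SetRel X Y :=
  p.graph.inv ○ q.graph

theorem mem_spanRel {p : P → X} {q : P → Y} {x : X} {y : Y} :
    x ~[spanRel p q] y ↔ ∃ w, p w = x ∧ q w = y :=
  .rfl

theorem spanRel_projections (r : SetRel X Y) :
    spanRel (fun z : r => z.1.1) (fun z : r => z.1.2) = r := by
  ext ⟨x, y⟩
  simp [mem_spanRel]

theorem spanRel_id_left (f : X → Y) : spanRel id f = f.graph := by
  simp [spanRel]

theorem spanRel_self_of_surjective {f : X → Y} (hf : f.Surjective) :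
    spanRel f f = SetRel.id := by
  ext ⟨y, y'⟩
  obtain ⟨x, rfl⟩ := hf y
  exact ⟨fun ⟨_, h, h'⟩ => h.symm.trans h', fun h => ⟨x, rfl, h⟩⟩

theorem spanRel_comp_of_surjective {e : P' → P} (he : e.Surjective) (p : P → X) (q : P → Y) :
    spanRel (p ∘ e) (q ∘ e) = spanRel p q := by
  ext ⟨x, y⟩
  simp only [mem_spanRel, Function.comp_apply, he.exists]

/-- The square with legs `p : P → X`, `q : P → Y` over the cospan `f : X → Z`, `g : Y → Z` is a weak
pullback: it commutes, and every pair on which `f` and `g` agree comes from an element of `P`. -/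
def IsWeakPullback (p : P → X) (q : P → Y) (f : X → Z) (g : Y → Z) : Prop :=
  spanRel p q = f.graph ○ g.graph.inv

theorem isWeakPullback_iff {p : P → X} {q : P → Y} {f : X → Z} {g : Y → Z} :
    IsWeakPullback p q f g ↔ ∀ x y, (∃ w, p w = x ∧ q w = y) ↔ f x = g y := by
  have h x y : x ~[f.graph ○ g.graph.inv] y ↔ f x = g y := by simp [eq_comm]
  simp only [IsWeakPullback, Set.ext_iff, Prod.forall, mem_spanRel, h]

theorem isWeakPullback_fst_snd (f : X → Z) (g : Y → Z) :
    IsWeakPullback (Function.Pullback.fst : f.Pullback g → X) Function.Pullback.snd f g := by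
  rw [isWeakPullback_iff]
  exact fun x y => ⟨fun ⟨w, hx, hy⟩ => hx ▸ hy ▸ w.2, fun h => ⟨⟨(x, y), h⟩, rfl, rfl⟩⟩

theorem isWeakPullback_prod (X Y : Type*) :
    IsWeakPullback (Prod.fst : X × Y → X) Prod.snd (fun _ => PUnit.unit) fun _ => PUnit.unit := by
  simp [isWeakPullback_iff]

theorem IsWeakPullback.spanRel_comp_spanRel {p : P → X} {q : P → Y} {f : X → Z} {g : Y → Z}
    (h : IsWeakPullback p q f g) (a : X → A) (b : Y → B) :
    spanRel a f ○ spanRel g b = spanRel (a ∘ p) (b ∘ q) :=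
  calc spanRel a f ○ spanRel g b = a.graph.inv ○ (f.graph ○ g.graph.inv) ○ b.graph := by
        simp only [spanRel, comp_assoc]
    _ = a.graph.inv ○ spanRel p q ○ b.graph := by rw [h]
    _ = spanRel (a ∘ p) (b ∘ q) := by
        simp only [spanRel, Function.graph_comp, inv_comp, comp_assoc]

end Span

/-! ### The Barr extension of a functor preserving weak pullbacks -/

section Barr

variable {F : Type u ⥤ Type u} {P X Y Z : Type u}

/-- `F` sends weak pullback squares of sets to weak pullback squares. -/
def PreservesWeakPullbacks (F : Type u ⥤ Type u) : Prop :=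
  ∀ ⦃P X Y Z : Type u⦄ ⦃p : P → X⦄ ⦃q : P → Y⦄ ⦃f : X → Z⦄ ⦃g : Y → Z⦄,
    IsWeakPullback p q f g → IsWeakPullback (F.map (↾p)) (F.map (↾q)) (F.map (↾f)) (F.map (↾g))

/-- A functorial action on relations between sets of the form `F X` that extends the action of `F`
on functions. Unlike an extension of `F`, it acts on objects as `F` by definition, which
avoids transport along equalities of objects. -/
@[ext]
structure RelLifting (F : Type u ⥤ Type u) where
  lift : ∀ {X Y : Type u}, SetRel X Y → SetRel (F.obj X) (F.obj Y)
  lift_comp : ∀ {X Y Z : Type u} (r : SetRel X Y) (s : SetRel Y Z),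
    lift (r ○ s) = lift r ○ lift s
  lift_graph : ∀ {X Y : Type u} (f : X → Y), lift f.graph = Function.graph (F.map (↾f))

theorem map_ofHom_comp (F : Type u ⥤ Type u) (g : Y → Z) (f : X → Y) :
    ⇑(F.map (↾(g ∘ f))) = F.map (↾g) ∘ F.map (↾f) :=
  funext <| Functor.map_comp_apply F (↾f) (↾g)

theorem map_ofHom_id (F : Type u ⥤ Type u) (X : Type u) : ⇑(F.map (↾(id : X → X))) = id :=
  funext <| Functor.map_id_apply F X

theorem map_ofHom_surjective (F : Type u ⥤ Type u) {f : X → Y} (hf : f.Surjective) :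
    Function.Surjective (F.map (↾f)) := by
  obtain ⟨s, hs⟩ := hf.hasRightInverse
  refine Function.RightInverse.surjective (g := F.map (↾s)) fun a => ?_
  rw [← Function.comp_apply (f := F.map (↾f)), ← map_ofHom_comp, hs.comp_eq_id, map_ofHom_id, id]

theorem barrRel_spanRel (F : Type u ⥤ Type u) (p : P → X) (q : P → Y) :
    barrRel F (spanRel p q) = spanRel (F.map (↾p)) (F.map (↾q)) := by
  let e : P → spanRel p q := fun w => ⟨(p w, q w), w, rfl, rfl⟩
  have he : e.Surjective := by
    rintro ⟨⟨x, y⟩, w, rfl : p w = x, rfl : q w = y⟩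
    exact ⟨w, rfl⟩
  calc barrRel F (spanRel p q)
      = spanRel (F.map (↾fun z : spanRel p q => z.1.1) ∘ F.map (↾e))
          (F.map (↾fun z : spanRel p q => z.1.2) ∘ F.map (↾e)) :=
        (spanRel_comp_of_surjective (map_ofHom_surjective F he) _ _).symm
    _ = spanRel (F.map (↾p)) (F.map (↾q)) := by
        rw [← map_ofHom_comp, ← map_ofHom_comp]

theorem barrRel_graph (F : Type u ⥤ Type u) (f : X → Y) :
    barrRel F f.graph = Function.graph (F.map (↾f)) := by
  rw [← spanRel_id_left, barrRel_spanRel, map_ofHom_id, spanRel_id_left]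

theorem PreservesWeakPullbacks.barrRel_comp (hF : PreservesWeakPullbacks F) (r : SetRel X Y)
    (s : SetRel Y Z) : barrRel F (r ○ s) = barrRel F r ○ barrRel F s := by
  have h := isWeakPullback_fst_snd (fun z : r => z.1.2) fun z : s => z.1.1
  calc barrRel F (r ○ s)
      = barrRel F (spanRel ((fun z : r => z.1.1) ∘ Function.Pullback.fst)
          ((fun z : s => z.1.2) ∘ Function.Pullback.snd)) := by
        rw [← h.spanRel_comp_spanRel, spanRel_projections, spanRel_projections]
    _ = spanRel (F.map (↾fun z : r => z.1.1) ∘ F.map (↾Function.Pullback.fst))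
          (F.map (↾fun z : s => z.1.2) ∘ F.map (↾Function.Pullback.snd)) := by
        rw [barrRel_spanRel, map_ofHom_comp F fun z : r => z.1.1,
          map_ofHom_comp F fun z : s => z.1.2]
    _ = barrRel F r ○ barrRel F s := ((hF h).spanRel_comp_spanRel _ _).symm

/-- The Barr extension of a functor preserving weak pullbacks, as a relation lifting. -/
def barrLifting (hF : PreservesWeakPullbacks F) : RelLifting F where
  lift := barrRel F
  lift_comp := hF.barrRel_comp
  lift_graph := barrRel_graph F

end Barr

/-! ### Extensions of functors with bounded supports -/

/-- Every element of `F X` is supported on a subset of `X` of cardinality less than some fixed `κ`,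
in the sense that its image under `F f` depends only on the restriction of `f` to that subset. -/
def IsBounded (F : Type u ⥤ Type u) : Prop :=
  ∃ κ : Cardinal.{u}, ∀ ⦃X : Type u⦄ (a : F.obj X), ∃ S : Set X, #S < κ ∧
    ∀ ⦃Y : Type u⦄ (f g : X → Y), S.EqOn f g → F.map (↾f) a = F.map (↾g) a

theorem exists_surjective_comp_eq_eqOn {P K : Type u} {X : Type*} {p : P → X} {d : X → P}
    (hd : Function.RightInverse d p) {S : Set (P × K)} (hS : #S < #K) :
    ∃ k : P × K → P, k.Surjective ∧ p ∘ k = p ∘ Prod.fst ∧ S.EqOn k (d ∘ p ∘ Prod.fst) := by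
  classical
  refine ⟨S.piecewise (d ∘ p ∘ Prod.fst) Prod.fst, fun w => ?_, ?_, S.piecewise_eqOn _ _⟩
  · obtain ⟨n, hn⟩ : ∃ n, n ∉ Prod.snd '' S := by
      by_contra! h
      have hlt : #(Prod.snd '' S) < #K := Cardinal.mk_image_le.trans_lt hS
      rw [Set.eq_univ_of_forall h, Cardinal.mk_univ] at hlt
      exact hlt.false
    exact ⟨(w, n), S.piecewise_eq_of_notMem _ _ fun hw => hn ⟨_, hw, rfl⟩⟩
  · funext z
    by_cases hz : z ∈ S <;> simp [hz, hd (p z.1)]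

namespace RelLifting

variable {F : Type u ⥤ Type u} (L : RelLifting F) {P X Y Z : Type u}

theorem lift_id (X : Type u) : L.lift (SetRel.id : SetRel X X) = SetRel.id := by
  rw [← Function.graph_id, L.lift_graph, map_ofHom_id, Function.graph_id]

theorem mem_lift_graph_comp {f : X → Y} {r : SetRel Y Z} {a : F.obj X} {b : F.obj Z} :
    a ~[L.lift (f.graph ○ r)] b ↔ F.map (↾f) a ~[L.lift r] b := by
  rw [L.lift_comp, L.lift_graph]
  simp

theorem mem_lift_comp_graph {r : SetRel X Y} {f : Y → Z} {a : F.obj X} {b : F.obj Z} :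
    a ~[L.lift (r ○ f.graph)] b ↔ ∃ c, a ~[L.lift r] c ∧ F.map (↾f) c = b := by
  rw [L.lift_comp, L.lift_graph]
  simp

theorem lift_inv_graph_comp_graph_of_surjective {f : X → Y} (hf : f.Surjective) :
    L.lift (f.graph.inv ○ f.graph) = SetRel.id :=
  (congrArg L.lift (spanRel_self_of_surjective hf)).trans (L.lift_id Y)

theorem map_eq_of_mem_lift_inv_graph_of_surjective {f : X → Y} (hf : f.Surjective) {a : F.obj Y}
    {b : F.obj X} (h : a ~[L.lift f.graph.inv] b) : F.map (↾f) b = a := by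
  have : a ~[L.lift (f.graph.inv ○ f.graph)] F.map (↾f) b := L.mem_lift_comp_graph.2 ⟨b, h, rfl⟩
  rw [L.lift_inv_graph_comp_graph_of_surjective hf] at this
  exact this.symm

theorem exists_mem_lift_inv_graph_of_surjective {f : X → Y} (hf : f.Surjective) (a : F.obj Y) :
    ∃ b, a ~[L.lift f.graph.inv] b := by
  have : a ~[L.lift (f.graph.inv ○ f.graph)] a := by
    rw [L.lift_inv_graph_comp_graph_of_surjective hf]
    rfl
  obtain ⟨b, h, -⟩ := L.mem_lift_comp_graph.1 this
  exact ⟨b, h⟩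

theorem mem_lift_inv_graph_of_rightInverse (hF : IsBounded F) {p : P → X} {d : X → P}
    (hd : Function.RightInverse d p) (a : F.obj X) :
    a ~[L.lift p.graph.inv] F.map (↾d) a := by
  obtain ⟨κ, hκ⟩ := hF
  have hK : Nonempty κ.out := by
    obtain ⟨S, hS, -⟩ := hκ a
    rw [← Cardinal.mk_ne_zero_iff, κ.mk_out]
    exact hS.ne_bot
  let q : P × κ.out → X := p ∘ Prod.fst
  have hq : q.Surjective := hd.surjective.comp Prod.fst_surjective
  obtain ⟨b, hb⟩ := L.exists_mem_lift_inv_graph_of_surjective hq a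
  obtain ⟨S, hS, hbS⟩ := hκ b
  obtain ⟨k, hk, hpk, hkS⟩ := exists_surjective_comp_eq_eqOn hd (hS.trans_eq κ.mk_out.symm)
  have hr : p.graph.inv = q.graph.inv ○ k.graph := by
    simpa [spanRel, hpk] using (spanRel_comp_of_surjective hk p id).symm
  have hkb : F.map (↾k) b = F.map (↾d) a := by
    rw [hbS k (d ∘ q) hkS, map_ofHom_comp, Function.comp_apply,
      L.map_eq_of_mem_lift_inv_graph_of_surjective hq hb]
  rw [hr, L.mem_lift_comp_graph]
  exact ⟨b, hb, hkb⟩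

theorem mem_lift_inv_graph_map (hF : IsBounded F) (f : X → Y) (a : F.obj X) :
    F.map (↾f) a ~[L.lift f.graph.inv] a := by
  let d : X → f.Pullback f := fun x => ⟨(x, x), rfl⟩
  have hd : F.map (↾Function.Pullback.snd) (F.map (↾d) a) = a := by
    rw [← Function.comp_apply (f := F.map _), ← map_ofHom_comp]
    exact congrFun (map_ofHom_id F X) a
  rw [← L.mem_lift_graph_comp, ← isWeakPullback_fst_snd f f, spanRel, L.mem_lift_comp_graph]
  exact ⟨_, L.mem_lift_inv_graph_of_rightInverse hF (fun _ => rfl) a, hd⟩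

theorem map_eq_of_mem_lift_inv_graph (hF : IsBounded F) {f : X → Y} {a : F.obj Y} {b : F.obj X}
    (h : a ~[L.lift f.graph.inv] b) : F.map (↾f) b = a := by
  -- Adjoining a copy of `Y` makes `f` surjective.
  let g : X ⊕ Y → Y := Sum.elim f id
  let k : X ⊕ Y → Y ⊕ Y := Sum.map f id
  let c : Y ⊕ Y → Y := Sum.elim id id
  have hg : g.Surjective := fun y => ⟨.inr y, rfl⟩
  have hgc : g = c ∘ k := (Sum.elim_comp_map (f₁ := f) (f₂ := id) (g₁ := id) (g₂ := id)).symm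
  have hsq : IsWeakPullback f (Sum.inl : X → X ⊕ Y) Sum.inl k := by
    rw [isWeakPullback_iff]
    rintro y (x | y') <;> simp [k, eq_comm]
  have hk : F.map (↾Sum.inl) a ~[L.lift k.graph.inv] F.map (↾Sum.inl) b := by
    rw [← L.mem_lift_graph_comp, ← hsq, spanRel, L.mem_lift_comp_graph]
    exact ⟨b, h, rfl⟩
  have hc : a ~[L.lift c.graph.inv] F.map (↾Sum.inl) a :=
    L.mem_lift_inv_graph_of_rightInverse hF (fun _ => rfl) a
  have hgb : a ~[L.lift g.graph.inv] F.map (↾Sum.inl) b := by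
    rw [hgc, Function.graph_comp, inv_comp, L.lift_comp]
    exact ⟨_, hc, hk⟩
  rw [← L.map_eq_of_mem_lift_inv_graph_of_surjective hg hgb, ← Function.comp_apply (f := F.map _),
    ← map_ofHom_comp, Sum.elim_comp_inl]

theorem lift_inv_graph (hF : IsBounded F) (f : X → Y) :
    L.lift f.graph.inv = (Function.graph (F.map (↾f))).inv := by
  ext ⟨a, b⟩
  constructor
  · exact L.map_eq_of_mem_lift_inv_graph hF
  · rintro (rfl : F.map (↾f) b = a)
    exact L.mem_lift_inv_graph_map hF f b

theorem lift_spanRel (hF : IsBounded F) (p : P → X) (q : P → Y) :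
    L.lift (spanRel p q) = spanRel (F.map (↾p)) (F.map (↾q)) := by
  rw [spanRel, L.lift_comp, L.lift_inv_graph hF, L.lift_graph, spanRel]

theorem lift_eq_barrRel (hF : IsBounded F) (r : SetRel X Y) : L.lift r = barrRel F r := by
  rw [← spanRel_projections r, L.lift_spanRel hF, barrRel_spanRel]

include L in
theorem preservesWeakPullbacks (hF : IsBounded F) : PreservesWeakPullbacks F := by
  intro P X Y Z p q f g h
  rw [IsWeakPullback, ← L.lift_spanRel hF, h, L.lift_comp, L.lift_graph, L.lift_inv_graph hF]

theorem eq_barrLifting (hF : IsBounded F) (hF' : PreservesWeakPullbacks F) :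
    L = barrLifting hF' := by
  ext X Y r : 4
  exact L.lift_eq_barrRel hF r

/-- The endofunctor of `Rel` given by a relation lifting. -/
def toFunctor : RelCat.{u} ⥤ RelCat.{u} where
  obj X := RelCat.graphFunctor.obj (F.obj X)
  map r := RelCat.Hom.ofRel (L.lift r.rel)
  map_id X := RelCat.Hom.ext _ _ (L.lift_id X)
  map_comp r s := RelCat.Hom.ext _ _ (L.lift_comp r.rel s.rel)

theorem isRelExtension_toFunctor : IsRelExtension F L.toFunctor :=
  Functor.hext (fun _ => rfl) fun _ _ f => heq_of_eq <| RelCat.Hom.ext _ _ <| L.lift_graph f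

end RelLifting

theorem IsRelExtension.exists_eq_toFunctor {F : Type u ⥤ Type u} {E : RelCat.{u} ⥤ RelCat.{u}}
    (hE : IsRelExtension F E) : ∃ L : RelLifting F, E = L.toFunctor := by
  obtain ⟨obj, map, hid, hcomp⟩ := E
  obtain rfl : obj = fun X => RelCat.graphFunctor.obj (F.obj X) :=
    funext fun X => Functor.congr_obj hE X
  refine ⟨⟨fun {X Y} r => (map (X := X) (Y := Y) (.ofRel r)).rel, fun {X Y Z} r s => ?_,
    fun f => ?_⟩, rfl⟩
  · exact congrArg RelCat.Hom.rel (@hcomp X Y Z (.ofRel r) (.ofRel s))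
  · exact congrArg RelCat.Hom.rel (eq_of_heq (Functor.hcongr_hom hE (↾f)))

theorem exists_isRelExtension_iff_preservesWeakPullbacks {F : Type u ⥤ Type u} (hF : IsBounded F) :
    (∃ E : RelCat.{u} ⥤ RelCat.{u}, IsRelExtension F E) ↔ PreservesWeakPullbacks F := by
  constructor
  · rintro ⟨E, hE⟩
    obtain ⟨L, -⟩ := hE.exists_eq_toFunctor
    exact L.preservesWeakPullbacks hF
  · exact fun h => ⟨_, (barrLifting h).isRelExtension_toFunctor⟩

/-! ### Weak pullbacks of finitely supported functions -/

section Finsupp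

variable {M : Type u} [AddCommMonoid M] {P X Y Z : Type*}

namespace IsPositiveMonoid

theorem subsingleton_addUnits (hM : IsPositiveMonoid M) : Subsingleton (AddUnits M) :=
  ⟨fun a b => AddUnits.ext <| (hM _ _ a.val_neg).1.trans (hM _ _ b.val_neg).1.symm⟩

theorem finsupp (hM : IsPositiveMonoid M) (X : Type*) : IsPositiveMonoid (X →₀ M) := by
  intro φ ψ h
  have hx x : φ x = 0 ∧ ψ x = 0 := hM _ _ (DFunLike.congr_fun h x)
  exact ⟨Finsupp.ext fun x => (hx x).1, Finsupp.ext fun x => (hx x).2⟩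

theorem mapDomain_eq_zero_iff (hM : IsPositiveMonoid M) (f : X → Y) (φ : X →₀ M) :
    φ.mapDomain f = 0 ↔ φ = 0 :=
  have := hM.subsingleton_addUnits
  Finsupp.mapDomain_apply_eq_zero_iff_of_subsingletonAddUnits f φ

theorem exists_single_of_add_eq_single (hM : IsPositiveMonoid M) {φ ψ : X →₀ M} {x : X} {a : M}
    (h : φ + ψ = Finsupp.single x a) :
    ∃ b c, b + c = a ∧ φ = Finsupp.single x b ∧ ψ = Finsupp.single x c := by
  have hne y (hy : y ≠ x) : φ y = 0 ∧ ψ y = 0 :=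
    hM _ _ <| by rw [← Finsupp.add_apply, h, Finsupp.single_eq_of_ne hy]
  refine ⟨φ x, ψ x, by rw [← Finsupp.add_apply, h, Finsupp.single_eq_same], ?_, ?_⟩ <;> ext y <;>
    obtain rfl | hy := eq_or_ne y x
  · simp
  · simp [hy, (hne y hy).1]
  · simp
  · simp [hy, (hne y hy).2]

end IsPositiveMonoid

theorem IsRefinableMonoid.finsupp (hR : IsRefinableMonoid M) (X : Type*) :
    IsRefinableMonoid (X →₀ M) := by
  classical
  intro a₁ a₂ b₁ b₂ h
  choose c₁₁ c₁₂ c₂₁ c₂₂ h₁ h₂ h₃ h₄ using fun x =>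
    hR (a₁ x) (a₂ x) (b₁ x) (b₂ x) (DFunLike.congr_fun h x)
  let s : Finset X := a₁.support ∪ a₂.support ∪ b₁.support ∪ b₂.support
  let restrict (c : X → M) : X →₀ M := Finsupp.indicator s fun x _ => c x
  have restrict_add {c c' : X → M} {φ : X →₀ M} (hφ : φ.support ⊆ s)
      (hc : ∀ x, c x + c' x = φ x) : restrict c + restrict c' = φ := by
    ext x
    by_cases hx : x ∈ s
    · simp [restrict, hx, hc]
    · simp [restrict, hx, Finsupp.notMem_support_iff.1 (mt (@hφ x) hx)]
  exact ⟨restrict c₁₁, restrict c₁₂, restrict c₂₁, restrict c₂₂,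
    restrict_add (by grind) h₁, restrict_add (by grind) h₂,
    restrict_add (by grind) h₃, restrict_add (by grind) h₄⟩

theorem exists_add_of_mapDomain_eq_add (hM : IsPositiveMonoid M) (hR : IsRefinableMonoid M)
    {g : Y → Z} {ψ : Y →₀ M} {α β : Z →₀ M} (h : ψ.mapDomain g = α + β) :
    ∃ ψ₁ ψ₂, ψ₁ + ψ₂ = ψ ∧ ψ₁.mapDomain g = α ∧ ψ₂.mapDomain g = β := by
  induction ψ using Finsupp.induction_linear generalizing α β with
  | zero =>
    rw [Finsupp.mapDomain_zero] at h
    obtain ⟨rfl, rfl⟩ := hM.finsupp Z _ _ h.symm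
    exact ⟨0, 0, by simp⟩
  | add ψ ψ' ih ih' =>
    rw [Finsupp.mapDomain_add] at h
    obtain ⟨c₁₁, c₁₂, c₂₁, c₂₂, h₁, h₂, rfl, rfl⟩ := hR.finsupp Z _ _ _ _ h
    obtain ⟨ψ₁, ψ₂, rfl, rfl, rfl⟩ := ih h₁.symm
    obtain ⟨ψ₁', ψ₂', rfl, rfl, rfl⟩ := ih' h₂.symm
    exact ⟨ψ₁ + ψ₁', ψ₂ + ψ₂', add_add_add_comm .., Finsupp.mapDomain_add, Finsupp.mapDomain_add⟩
  | single y c =>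
    rw [Finsupp.mapDomain_single] at h
    obtain ⟨a, b, rfl, rfl, rfl⟩ := hM.exists_single_of_add_eq_single h.symm
    exact ⟨Finsupp.single y a, Finsupp.single y b, (Finsupp.single_add ..).symm,
      Finsupp.mapDomain_single, Finsupp.mapDomain_single⟩

theorem exists_mapDomain_eq_single_of_mapDomain_eq_single (hM : IsPositiveMonoid M) {p : P → X}
    {q : P → Y} {g : Y → Z} {x : X} {z : Z} (hx : ∀ y, g y = z → ∃ w, p w = x ∧ q w = y)
    {ψ : Y →₀ M} {a : M} (h : ψ.mapDomain g = Finsupp.single z a) :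
    ∃ ω : P →₀ M, ω.mapDomain p = Finsupp.single x a ∧ ω.mapDomain q = ψ := by
  induction ψ using Finsupp.induction_linear generalizing a with
  | zero =>
    obtain rfl : a = 0 := by simpa using h.symm
    exact ⟨0, by simp⟩
  | add ψ ψ' ih ih' =>
    rw [Finsupp.mapDomain_add] at h
    obtain ⟨b, c, rfl, hb, hc⟩ := hM.exists_single_of_add_eq_single h
    obtain ⟨ω, hω, rfl⟩ := ih hb
    obtain ⟨ω', hω', rfl⟩ := ih' hc
    exact ⟨ω + ω', by rw [Finsupp.mapDomain_add, hω, hω', Finsupp.single_add],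
      Finsupp.mapDomain_add⟩
  | single y c =>
    rw [Finsupp.mapDomain_single, Finsupp.single_eq_single_iff] at h
    obtain ⟨hy, rfl⟩ | ⟨rfl, rfl⟩ := h
    · obtain ⟨w, rfl, rfl⟩ := hx y hy
      exact ⟨Finsupp.single w c, Finsupp.mapDomain_single, Finsupp.mapDomain_single⟩
    · exact ⟨0, by simp⟩

theorem exists_mapDomain_eq_of_mapDomain_eq (hM : IsPositiveMonoid M) (hR : IsRefinableMonoid M)
    {p : P → X} {q : P → Y} {f : X → Z} {g : Y → Z}
    (hw : ∀ x y, f x = g y → ∃ w, p w = x ∧ q w = y) {φ : X →₀ M} {ψ : Y →₀ M}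
    (h : φ.mapDomain f = ψ.mapDomain g) :
    ∃ ω : P →₀ M, ω.mapDomain p = φ ∧ ω.mapDomain q = ψ := by
  induction φ using Finsupp.induction_linear generalizing ψ with
  | zero =>
    obtain rfl : ψ = 0 := (hM.mapDomain_eq_zero_iff g ψ).1 (by simp [← h])
    exact ⟨0, by simp⟩
  | add φ φ' ih ih' =>
    rw [Finsupp.mapDomain_add] at h
    obtain ⟨ψ₁, ψ₂, rfl, h₁, h₂⟩ := exists_add_of_mapDomain_eq_add hM hR h.symm
    obtain ⟨ω, rfl, rfl⟩ := ih h₁.symm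
    obtain ⟨ω', rfl, rfl⟩ := ih' h₂.symm
    exact ⟨ω + ω', Finsupp.mapDomain_add, Finsupp.mapDomain_add⟩
  | single x a =>
    rw [Finsupp.mapDomain_single] at h
    exact exists_mapDomain_eq_single_of_mapDomain_eq_single hM (fun y hy => hw x y hy.symm) h.symm

theorem IsWeakPullback.mapDomain (hM : IsPositiveMonoid M) (hR : IsRefinableMonoid M)
    {p : P → X} {q : P → Y} {f : X → Z} {g : Y → Z} (h : IsWeakPullback p q f g) :
    IsWeakPullback (Finsupp.mapDomain p : (P →₀ M) → X →₀ M) (Finsupp.mapDomain q)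
      (Finsupp.mapDomain f) (Finsupp.mapDomain g) := by
  rw [isWeakPullback_iff] at h ⊢
  refine fun φ ψ => ⟨?_, exists_mapDomain_eq_of_mapDomain_eq hM hR fun x y => (h x y).2⟩
  rintro ⟨ω, rfl, rfl⟩
  rw [← Finsupp.mapDomain_comp, ← Finsupp.mapDomain_comp]
  exact Finsupp.mapDomain_congr fun w _ => (h _ _).1 ⟨w, rfl, rfl⟩

theorem mapDomain_fst_apply [Fintype Y] (ω : X × Y →₀ M) (x : X) :
    ω.mapDomain Prod.fst x = ∑ y, ω (x, y) := by
  classical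
  induction ω using Finsupp.induction_linear with
  | zero => simp
  | add ω ω' ih ih' => simp [Finsupp.mapDomain_add, ih, ih', Finset.sum_add_distrib]
  | single z a =>
    obtain ⟨x', y'⟩ := z
    by_cases h : x' = x <;> simp [Finsupp.single_apply, h]

theorem mapDomain_snd_apply [Fintype X] (ω : X × Y →₀ M) (y : Y) :
    ω.mapDomain Prod.snd y = ∑ x, ω (x, y) := by
  classical
  induction ω using Finsupp.induction_linear with
  | zero => simp
  | add ω ω' ih ih' => simp [Finsupp.mapDomain_add, ih, ih', Finset.sum_add_distrib]
  | single z a =>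
    obtain ⟨x', y'⟩ := z
    by_cases h : y' = y <;> simp [Finsupp.single_apply, h]

end Finsupp

/-! ### The monoid-valued functor -/

section MonoidValued

variable {M : Type u} [AddCommMonoid M]

theorem isBounded_monoidValued (M : Type u) [AddCommMonoid M] : IsBounded (monoidValued M) :=
  ⟨ℵ₀, fun _ (φ : _ →₀ M) => ⟨φ.support, Cardinal.lt_aleph0_of_finite _, fun _ _ _ h =>
    Finsupp.mapDomain_congr h⟩⟩

namespace PreservesWeakPullbacks

theorem exists_mapDomain_fst_snd (h : PreservesWeakPullbacks (monoidValued M)) {X Y : Type u}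
    {φ : X →₀ M} {ψ : Y →₀ M}
    (hmass : φ.mapDomain (fun _ => PUnit.unit.{u + 1}) = ψ.mapDomain fun _ => PUnit.unit) :
    ∃ ω : X × Y →₀ M, ω.mapDomain Prod.fst = φ ∧ ω.mapDomain Prod.snd = ψ :=
  (isWeakPullback_iff.1 (h (isWeakPullback_prod X Y)) φ ψ).2 hmass

theorem isPositiveMonoid (h : PreservesWeakPullbacks (monoidValued M)) : IsPositiveMonoid M := by
  intro a b hab
  let φ : PUnit.{u + 1} ⊕ PUnit.{u + 1} →₀ M :=
    Finsupp.single (.inl ⟨⟩) a + Finsupp.single (.inr ⟨⟩) b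
  obtain ⟨ω, hω, -⟩ := h.exists_mapDomain_fst_snd (φ := φ) (ψ := (0 : PEmpty →₀ M))
    (by simp [φ, Finsupp.mapDomain_add, ← Finsupp.single_add, hab])
  have hφ : φ = 0 := by rw [← hω, Subsingleton.elim ω 0, Finsupp.mapDomain_zero]
  exact ⟨by simpa [φ] using DFunLike.congr_fun hφ (.inl ⟨⟩),
    by simpa [φ] using DFunLike.congr_fun hφ (.inr ⟨⟩)⟩

theorem isRefinableMonoid (h : PreservesWeakPullbacks (monoidValued M)) :
    IsRefinableMonoid M := by
  intro a₁ a₂ b₁ b₂ hab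
  let pair (a b : M) : PUnit.{u + 1} ⊕ PUnit.{u + 1} →₀ M :=
    Finsupp.single (.inl ⟨⟩) a + Finsupp.single (.inr ⟨⟩) b
  obtain ⟨ω, hfst, hsnd⟩ := h.exists_mapDomain_fst_snd (φ := pair a₁ a₂) (ψ := pair b₁ b₂)
    (by simp [pair, Finsupp.mapDomain_add, ← Finsupp.single_add, hab])
  have hrow i : ω (i, .inl ⟨⟩) + ω (i, .inr ⟨⟩) = pair a₁ a₂ i := by
    simp [← hfst, mapDomain_fst_apply]
  have hcol j : ω (.inl ⟨⟩, j) + ω (.inr ⟨⟩, j) = pair b₁ b₂ j := by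
    simp [← hsnd, mapDomain_snd_apply]
  refine ⟨_, _, _, _, (hrow (.inl ⟨⟩)).trans ?_, (hrow (.inr ⟨⟩)).trans ?_,
    (hcol (.inl ⟨⟩)).trans ?_, (hcol (.inr ⟨⟩)).trans ?_⟩ <;> simp [pair]

end PreservesWeakPullbacks

theorem preservesWeakPullbacks_monoidValued_iff :
    PreservesWeakPullbacks (monoidValued M) ↔ IsPositiveMonoid M ∧ IsRefinableMonoid M :=
  ⟨fun h => ⟨h.isPositiveMonoid, h.isRefinableMonoid⟩,
    fun ⟨hM, hR⟩ _ _ _ _ _ _ _ _ h => h.mapDomain hM hR⟩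

end MonoidValued

theorem mainTheorem4 (M : Type u) [AddCommMonoid M] :
    ((∃ E : RelCat.{u} ⥤ RelCat.{u}, IsRelExtension (monoidValued M) E) ↔
      IsPositiveMonoid M ∧ IsRefinableMonoid M) ∧
    (IsPositiveMonoid M ∧ IsRefinableMonoid M →
      ∃ E : RelCat.{u} ⥤ RelCat.{u},
        IsRelExtension (monoidValued M) E ∧
        E.toPrefunctor = barrExtension (monoidValued M) ∧
        ∀ E' : RelCat.{u} ⥤ RelCat.{u}, IsRelExtension (monoidValued M) E' → E' = E) := by
  have hF := isBounded_monoidValued M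
  refine ⟨(exists_isRelExtension_iff_preservesWeakPullbacks hF).trans
    preservesWeakPullbacks_monoidValued_iff, fun hM => ?_⟩
  have hF' := preservesWeakPullbacks_monoidValued_iff.2 hM
  refine ⟨(barrLifting hF').toFunctor, (barrLifting hF').isRelExtension_toFunctor, rfl,
    fun E' hE' => ?_⟩
  obtain ⟨L, rfl⟩ := hE'.exists_eq_toFunctor
  rw [L.eq_barrLifting hF hF']
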